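/- **Setting.** A function $h:\mathbb R\to\mathbb R$ is an *impact function* if it is continuous and strictly increasing, $h(0)=0$, and $x\mapsto xh(x)$ is convex. An *Almgren–Chriss model* $(\gamma,h,P^0)$ consists of $\gamma>0$, an impact function $h$, and a càdlàg martingale $(P^0_t)_{t\ge0}$ on a filtered probability space $(\Omega,\mathcal F,(\mathcal F_t),\mathbb P)$ with $\mathbb P$-trivial $\mathcal F_0$. A *dark-pool extension* $(\alpha,\beta,\kappa,(\tau_i)_{i\ge1},(\widetilde Y_i)_{i\ge1})$ consists of $\alpha\in[0,1]$, an impact function $\beta$, $\kappa\ge0$, random times $0<\tau_1<\tau_2<\cdots$ (finite, a.s. ordered in this way), and random sizes $\widetilde Y_i\in(0,\infty]$. Given a dark-pool order $\widehat X\in\mathbb R$ and a minimum quantity level $\Xi\in[0,|\widehat X|]$, the executions are defined recursively as follows, with $s_i=\sum_{j<i}|Y_j|$: if $\widetilde Y_i\ge\Xi$ then $Y_i=\operatorname{sgn}(\widehat X)\min(\widetilde Y_i,|\widehat X|-s_i)$; otherwise $Y_i=0$. Put $Z_t=\sum_{i:\tau_i\le t}Y_i$, $Z_{t-}=\sum_{i:\tau_i<t}Y_i$,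 and let $(\mathcal G_t)$ be the right-continuous filtration generated by $(\mathcal F_t)$, $Z$ and the processes $(\tau_i\wedge t)_{t\ge0}$, $i\ge1$. It is assumed that (a) $\inf_{0<\delta\le1}\frac1\delta\mathbb P[\tau_1\le\delta]>0$; (b) $\inf_{\delta>0}\mathbb P[\widetilde Y_1\ge x\mid\tau_1\le\delta]>0$ for every $x>0$; (c) $P^0$ is also a $(\mathcal G_t)$-martingale, for every choice of $\widehat X$ and $\Xi$. For $X_0\in\mathbb R$ and $T>0$, an *admissible strategy* is a quadruple $\chi=(\widehat X,\Xi,\xi,\rho)$ where $\widehat X\in\mathbb R$, $\Xi\in[0,|\widehat X|]$, $\rho$ is a $(\mathcal G_t)$-stopping time with $\rho<T$ a.s., and $\xi$ is a $(\mathcal G_t)$-predictable process, a.s. integrable on $[0,T]$, such that $\int_0^t\xi_s\,ds$, $t\le T$, is a.s. bounded uniformly in $t$ and $\omega$, and $X_0+\int_0^T\xi_t\,dt+Z_\rho=0$ a.s. Its costs are $$\mathcal C_T^\chi=X_0P^0_0+\int_0^T\xi_tP^\chi_t\,dt+\alpha\gamma\int_0^TZ_{\rho\wedge t}\,\xi_t\,dt+\sum_{i:\tau_i\le\rho}Y_i\Big(\widehat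 P^\chi_{\tau_i}+\alpha\gamma Z_{\tau_i-}+\beta(Y_i)\Big),$$ where $P^\chi_t=P^0_t+\gamma\int_0^t\xi_s\,ds+h(\xi_t)$ and $\widehat P^\chi_{\tau_i}=P^0_{\tau_i}+\gamma\int_0^{\tau_i}\xi_s\,ds+\kappa h(\xi_{\tau_i})$. There is *price manipulation for the horizon $T$* if some admissible strategy with $X_0=0$ has $\mathbb E[\mathcal C^\chi_T]<0$ (the costs being a.s. finite, and the expectation being well defined in $[-\infty,\infty)$). **Proposition.** Fix an Almgren–Chriss model and a dark-pool extension of it. 1. If $T>0$ and there is no price manipulation for the horizon $T$, then $$\beta(y)\,y\ \ge\ \gamma\Big(\alpha-\frac12\Big)y^2+y\,h(-y/T)\qquad\text{for all }y\in\mathbb R.$$ 2. If there is no price manipulation for any horizon $T>0$, then $$|\beta(y)|\ \ge\ \gamma\Big(\alpha-\frac12\Big)|y|\qquad\text{for all }y\in\mathbb R.$$ -/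

import Mathlib

open MeasureTheory Filter Topology
open scoped NNReal ENNReal

noncomputable section

/-- Impact functions: continuous, strictly increasing, vanishing at `0`, with `x ↦ x h(x)` convex. -/
structure IsImpactFunction (h : ℝ → ℝ) : Prop where
  continuous : Continuous h
  strictMono : StrictMono h
  map_zero : h 0 = 0
  convexOn : ConvexOn ℝ Set.univ (fun x => x * h x)

/-- Right-continuous with left limits. -/
def IsCadlag (f : ℝ≥0 → ℝ) : Prop :=
  ∀ t, ContinuousWithinAt f (Set.Ici t) t ∧ ∃ l, Tendsto f (𝓝[<] t) (𝓝 l)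

/-- An Almgren--Chriss model `(γ, h, P⁰)` on the filtered probability space `(Ω, m, (F_t), ℙ)`. -/
structure AlmgrenChriss {Ω : Type*} [m : MeasurableSpace Ω] (ℙ : Measure Ω) where
  γ : ℝ
  γ_pos : 0 < γ
  h : ℝ → ℝ
  h_impact : IsImpactFunction h
  F : Filtration ℝ≥0 m
  F_zero_trivial : ∀ A, MeasurableSet[F 0] A → ℙ A = 0 ∨ ℙ A = 1
  P0 : ℝ≥0 → Ω → ℝ
  P0_cadlag : ∀ ω, IsCadlag (fun t => P0 t ω)
  P0_martingale : Martingale P0 F ℙ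

namespace DarkPool

/-- The number of shares taken from an order of absolute size `|X|` with minimum quantity level
`Ξ`, of which `s` shares have been executed so far, when a matching order of size `y` arrives. -/
def fillSize (X Ξ s : ℝ) (y : ℝ≥0∞) : ℝ :=
  if ENNReal.ofReal Ξ ≤ y ∧ ENNReal.ofReal s + y ≤ ENNReal.ofReal |X| then y.toReal
  else if ENNReal.ofReal Ξ ≤ y then |X| - s
  else 0

/-- The number of shares executed against the first `n` incoming orders. -/
def cumFill (X Ξ : ℝ) (y : ℕ → ℝ≥0∞) : ℕ → ℝ
  | 0 => 0
  | n + 1 => cumFill X Ξ y n + fillSize X Ξ (cumFill X Ξ y n) (y n)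

/-- The signed number `Y_i` of shares executed against the `i`-th incoming order
(incoming orders are numbered from `0`). -/
def fill (X Ξ : ℝ) (y : ℕ → ℝ≥0∞) (i : ℕ) : ℝ :=
  Real.sign X * fillSize X Ξ (cumFill X Ξ y i) (y i)

/-- `Z_t`, the number of shares executed in the dark pool up to and including time `t`, for
arrival times `τ i`: the sum of the `Y_i` over all `i` with `τ i ≤ t`. -/
def Z (X Ξ : ℝ) (τ : ℕ → ℝ≥0) (y : ℕ → ℝ≥0∞) (t : ℝ≥0) : ℝ :=
  ∑' i, if τ i ≤ t then fill X Ξ y i else 0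

/-- `Z_{t-}`, the number of shares executed in the dark pool strictly before time `t`. -/
def Zleft (X Ξ : ℝ) (τ : ℕ → ℝ≥0) (y : ℕ → ℝ≥0∞) (t : ℝ≥0) : ℝ :=
  ∑' i, if τ i < t then fill X Ξ y i else 0

lemma fillSize_nonneg_le (X Ξ s : ℝ) (hs : 0 ≤ s) (hsX : s ≤ |X|) (y : ℝ≥0∞) :
    0 ≤ fillSize X Ξ s y ∧ s + fillSize X Ξ s y ≤ |X| := by
  unfold fillSize
  split_ifs with h1 h2
  · refine ⟨ENNReal.toReal_nonneg, ?_⟩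
    have h := ENNReal.toReal_mono ENNReal.ofReal_ne_top h1.2
    have hy : y ≠ ∞ := by
      rintro rfl
      have := h1.2
      simp at this
    rwa [ENNReal.toReal_add ENNReal.ofReal_ne_top hy, ENNReal.toReal_ofReal hs,
      ENNReal.toReal_ofReal (abs_nonneg X)] at h
  · constructor <;> linarith
  · constructor <;> linarith

lemma cumFill_nonneg_le (X Ξ : ℝ) (y : ℕ → ℝ≥0∞) (n : ℕ) :
    0 ≤ cumFill X Ξ y n ∧ cumFill X Ξ y n ≤ |X| := by
  induction n with
  | zero => simp [cumFill]
  | succ n ih =>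
    have h := fillSize_nonneg_le X Ξ _ ih.1 ih.2 (y n)
    simp only [cumFill]
    exact ⟨add_nonneg ih.1 h.1, h.2⟩

lemma sum_fillSize (X Ξ : ℝ) (y : ℕ → ℝ≥0∞) (n : ℕ) :
    ∑ i ∈ Finset.range n, fillSize X Ξ (cumFill X Ξ y i) (y i) = cumFill X Ξ y n := by
  induction n with
  | zero => simp [cumFill]
  | succ n ih => rw [Finset.sum_range_succ, ih]; rfl

lemma summable_fillSize (X Ξ : ℝ) (y : ℕ → ℝ≥0∞) :
    Summable (fun i => fillSize X Ξ (cumFill X Ξ y i) (y i)) := by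
  refine summable_of_sum_range_le (c := |X|) (fun i => ?_) (fun n => ?_)
  · exact (fillSize_nonneg_le X Ξ _ (cumFill_nonneg_le X Ξ y i).1
      (cumFill_nonneg_le X Ξ y i).2 (y i)).1
  · rw [sum_fillSize]
    exact (cumFill_nonneg_le X Ξ y n).2

lemma summable_ite_fill (X Ξ : ℝ) (y : ℕ → ℝ≥0∞) (p : ℕ → Prop) [DecidablePred p] :
    Summable (fun i => if p i then fill X Ξ y i else 0) := by
  refine ((summable_fillSize X Ξ y).mul_left (Real.sign X)).indicator {i | p i} |>.congr ?_
  intro i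
  by_cases h : p i <;> simp [h, fill]

section Measurability

variable {Ω : Type*} [m : MeasurableSpace Ω]

lemma measurable_fillSize (X Ξ : ℝ) :
    Measurable (fun q : ℝ × ℝ≥0∞ => fillSize X Ξ q.1 q.2) := by
  unfold fillSize
  have h1 : MeasurableSet {q : ℝ × ℝ≥0∞ | ENNReal.ofReal Ξ ≤ q.2} :=
    measurableSet_le measurable_const measurable_snd
  have h2 : MeasurableSet {q : ℝ × ℝ≥0∞ | ENNReal.ofReal q.1 + q.2 ≤ ENNReal.ofReal |X|} :=
    measurableSet_le ((ENNReal.measurable_ofReal.comp measurable_fst).add measurable_snd)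
      measurable_const
  exact Measurable.ite (h1.inter h2) (ENNReal.measurable_toReal.comp measurable_snd)
    (Measurable.ite h1 (measurable_const.sub measurable_fst) measurable_const)

lemma measurable_cumFill (X Ξ : ℝ) {Y : ℕ → Ω → ℝ≥0∞} (hY : ∀ i, Measurable (Y i)) (n : ℕ) :
    Measurable (fun ω => cumFill X Ξ (fun i => Y i ω) n) := by
  induction n with
  | zero => exact measurable_const
  | succ n ih => exact ih.add ((measurable_fillSize X Ξ).comp (ih.prodMk (hY n)))

lemma measurable_fill (X Ξ : ℝ) {Y : ℕ → Ω → ℝ≥0∞} (hY : ∀ i, Measurable (Y i)) (i : ℕ) :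
    Measurable (fun ω => fill X Ξ (fun i => Y i ω) i) :=
  ((measurable_fillSize X Ξ).comp ((measurable_cumFill X Ξ hY i).prodMk (hY i))).const_mul _

lemma measurable_Z (X Ξ : ℝ) {τ : ℕ → Ω → ℝ≥0} (hτ : ∀ i, Measurable (τ i))
    {Y : ℕ → Ω → ℝ≥0∞} (hY : ∀ i, Measurable (Y i)) (t : ℝ≥0) :
    Measurable (fun ω => Z X Ξ (fun i => τ i ω) (fun i => Y i ω) t) := by
  refine measurable_of_tendsto_metrizable
    (f := fun n ω => ∑ i ∈ Finset.range n,
      if τ i ω ≤ t then fill X Ξ (fun i => Y i ω) i else 0) (fun n => ?_) ?_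
  · refine Finset.measurable_sum _ fun i _ => ?_
    exact Measurable.ite (measurableSet_le (hτ i) measurable_const) (measurable_fill X Ξ hY i)
      measurable_const
  · rw [tendsto_pi_nhds]
    intro ω
    exact (summable_ite_fill X Ξ (fun i => Y i ω) (fun i => τ i ω ≤ t)).hasSum.tendsto_sum_nat

/-- `(G_t)`, the right-continuous filtration generated by `(F_t)`, by `Z` (for the dark-pool order
`X` with minimum quantity level `Ξ`), and by the processes `(τ_i ∧ t)_{t ≥ 0}`. -/
def G (F : Filtration ℝ≥0 m) (τ : ℕ → Ω → ℝ≥0) (hτ : ∀ i, Measurable (τ i))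
    (Y : ℕ → Ω → ℝ≥0∞) (hY : ∀ i, Measurable (Y i)) (X Ξ : ℝ) : Filtration ℝ≥0 m :=
  (F ⊔ Filtration.natural (fun t ω => Z X Ξ (fun i => τ i ω) (fun i => Y i ω) t)
        (fun t => (measurable_Z X Ξ hτ hY t).stronglyMeasurable)
    ⊔ ⨆ i, Filtration.natural (fun t ω => min (τ i ω) t)
        (fun _ => ((hτ i).min measurable_const).stronglyMeasurable)).rightCont

end Measurability

end DarkPool

/-- A dark-pool extension `(α, β, κ, (τ_i), (Ỹ_i))` of an Almgren--Chriss model. The arrival times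
and sizes are numbered from `0`, and an incoming order may be infinitely large. -/
structure DarkPoolExtension {Ω : Type*} [m : MeasurableSpace Ω] {ℙ : Measure Ω}
    (M : AlmgrenChriss ℙ) where
  α : ℝ
  α_mem : α ∈ Set.Icc (0 : ℝ) 1
  β : ℝ → ℝ
  β_impact : IsImpactFunction β
  κ : ℝ
  κ_nonneg : 0 ≤ κ
  τ : ℕ → Ω → ℝ≥0
  τ_measurable : ∀ i, Measurable (τ i)
  τ_pos : ∀ᵐ ω ∂ℙ, 0 < τ 0 ω
  τ_strictMono : ∀ᵐ ω ∂ℙ, StrictMono (fun i => τ i ω)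
  Y : ℕ → Ω → ℝ≥0∞
  Y_measurable : ∀ i, Measurable (Y i)
  Y_pos : ∀ᵐ ω ∂ℙ, ∀ i, 0 < Y i ω
  lambda0_pos : 0 < ⨅ δ ∈ Set.Ioc (0 : ℝ≥0) 1, ℙ {ω | τ 0 ω ≤ δ} / δ
  lambda1_pos : ∀ x : ℝ, 0 < x →
    0 < ⨅ δ ∈ Set.Ioi (0 : ℝ≥0),
      ProbabilityTheory.cond ℙ {ω | τ 0 ω ≤ δ} {ω | ENNReal.ofReal x ≤ Y 0 ω}
  P0_martingale : ∀ X Ξ : ℝ, Ξ ∈ Set.Icc 0 |X| →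
    Martingale M.P0 (DarkPool.G M.F τ τ_measurable Y Y_measurable X Ξ) ℙ

/-- A candidate strategy `χ = (X̂, Ξ, ξ, ρ)`. -/
structure DarkPoolStrategy (Ω : Type*) where
  Xhat : ℝ
  Ξ : ℝ
  ξ : ℝ≥0 → Ω → ℝ
  ρ : Ω → ℝ≥0

/-- `∫₀ᵗ ξ_s ds`. -/
def DarkPoolStrategy.intξ {Ω : Type*} (χ : DarkPoolStrategy Ω) (t : ℝ) (ω : Ω) : ℝ :=
  ∫ s in (0 : ℝ)..t, χ.ξ s.toNNReal ω

namespace DarkPoolExtension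

variable {Ω : Type*} [m : MeasurableSpace Ω] {ℙ : Measure Ω} {M : AlmgrenChriss ℙ}

/-- The filtration `(G_t)` that belongs to the dark-pool order of `χ`. -/
def G (D : DarkPoolExtension M) (χ : DarkPoolStrategy Ω) : Filtration ℝ≥0 m :=
  DarkPool.G M.F D.τ D.τ_measurable D.Y D.Y_measurable χ.Xhat χ.Ξ

/-- The execution `Y_i`. -/
def fill (D : DarkPoolExtension M) (χ : DarkPoolStrategy Ω) (i : ℕ) (ω : Ω) : ℝ :=
  DarkPool.fill χ.Xhat χ.Ξ (fun i => D.Y i ω) i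

/-- `Z_t`. -/
def Z (D : DarkPoolExtension M) (χ : DarkPoolStrategy Ω) (t : ℝ≥0) (ω : Ω) : ℝ :=
  DarkPool.Z χ.Xhat χ.Ξ (fun i => D.τ i ω) (fun i => D.Y i ω) t

/-- `Z_{t-}`. -/
def Zleft (D : DarkPoolExtension M) (χ : DarkPoolStrategy Ω) (t : ℝ≥0) (ω : Ω) : ℝ :=
  DarkPool.Zleft χ.Xhat χ.Ξ (fun i => D.τ i ω) (fun i => D.Y i ω) t

/-- `χ` is an admissible strategy for the initial position `X₀` and the horizon `T`. -/
structure IsAdmissible (D : DarkPoolExtension M) (X₀ T : ℝ) (χ : DarkPoolStrategy Ω) : Prop where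
  Ξ_mem : χ.Ξ ∈ Set.Icc 0 |χ.Xhat|
  ρ_stopping : IsStoppingTime (D.G χ) (fun ω => (χ.ρ ω : WithTop ℝ≥0))
  ρ_lt : ∀ᵐ ω ∂ℙ, (χ.ρ ω : ℝ) < T
  ξ_predictable : IsStronglyPredictable (D.G χ) χ.ξ
  ξ_integrable : ∀ᵐ ω ∂ℙ, IntervalIntegrable (fun t : ℝ => χ.ξ t.toNNReal ω) volume 0 T
  intξ_bounded : ∃ C : ℝ, ∀ᵐ ω ∂ℙ, ∀ t ∈ Set.Icc 0 T, |χ.intξ t ω| ≤ C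
  liquidation : ∀ᵐ ω ∂ℙ, X₀ + χ.intξ T ω + D.Z χ (χ.ρ ω) ω = 0

/-- The price `P^χ_t` at the exchange. -/
def exchangePrice (_ : DarkPoolExtension M) (χ : DarkPoolStrategy Ω) (t : ℝ≥0) (ω : Ω) : ℝ :=
  M.P0 t ω + M.γ * χ.intξ t ω + M.h (χ.ξ t ω)

/-- The price at which the `i`-th incoming order is executed in the dark pool. -/
def darkPrice (D : DarkPoolExtension M) (χ : DarkPoolStrategy Ω) (i : ℕ) (ω : Ω) : ℝ :=
  M.P0 (D.τ i ω) ω + M.γ * χ.intξ (D.τ i ω) ω + D.κ * M.h (χ.ξ (D.τ i ω) ω)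

/-- The contribution of the `i`-th incoming order to the costs; it is zero unless the order arrives
up to the cancellation time `ρ`. -/
def darkCost (D : DarkPoolExtension M) (χ : DarkPoolStrategy Ω) (i : ℕ) (ω : Ω) : ℝ :=
  if D.τ i ω ≤ χ.ρ ω then
    D.fill χ i ω *
      (D.darkPrice χ i ω + D.α * M.γ * D.Zleft χ (D.τ i ω) ω + D.β (D.fill χ i ω))
  else 0

/-- The costs `C_T^χ`. -/
def cost (D : DarkPoolExtension M) (X₀ T : ℝ) (χ : DarkPoolStrategy Ω) (ω : Ω) : ℝ :=
  X₀ * M.P0 0 ω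
    + (∫ t in (0 : ℝ)..T, χ.ξ t.toNNReal ω * D.exchangePrice χ t.toNNReal ω)
    + D.α * M.γ * (∫ t in (0 : ℝ)..T, D.Z χ (min (χ.ρ ω) t.toNNReal) ω * χ.ξ t.toNNReal ω)
    + ∑' i, D.darkCost χ i ω

/-- The costs of `χ` are finite almost surely. For an admissible strategy the first integral in the
costs can only fail to converge by being `+∞`, because `x h(x) ≥ 0`; the sum is finite whenever
only finitely many orders arrive up to time `ρ`. -/
def FiniteCost (D : DarkPoolExtension M) (T : ℝ) (χ : DarkPoolStrategy Ω) : Prop :=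
  ∀ᵐ ω ∂ℙ,
    IntervalIntegrable
      (fun t : ℝ => χ.ξ t.toNNReal ω * D.exchangePrice χ t.toNNReal ω) volume 0 T ∧
    Summable (fun i => D.darkCost χ i ω)

/-- `E[C_T^χ] < 0`, the expectation being taken in `[-∞, ∞]`: the costs are almost surely finite and
the expectation of their positive part is smaller than that of their negative part. -/
def NegativeExpectedCost (D : DarkPoolExtension M) (X₀ T : ℝ) (χ : DarkPoolStrategy Ω) : Prop :=
  D.FiniteCost T χ ∧
    ∫⁻ ω, ENNReal.ofReal (D.cost X₀ T χ ω) ∂ℙ < ∫⁻ ω, ENNReal.ofReal (-D.cost X₀ T χ ω) ∂ℙ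

/-- There is price manipulation for the horizon `T`: some round trip (an admissible strategy with
`X₀ = 0`) has strictly negative expected costs. -/
def PriceManipulation (D : DarkPoolExtension M) (T : ℝ) : Prop :=
  ∃ χ : DarkPoolStrategy Ω, D.IsAdmissible 0 T χ ∧ D.NegativeExpectedCost 0 T χ

end DarkPoolExtension

end

/-! A single round trip does everything. Place an order of size y in the dark pool with minimum
quantity |y|, so that it is filled completely or not at all. Cancel it at a deterministic time d in
(0, T), and unwind whatever was filled at constant speed over (d, T].

Without a fill nothing is traded. After a fill at time s, permanent impact costs γy²/2 during the
unwinding, the cross-impact term gives -αγy², temporary impact gives -y h(-y/(T-d)), and the dark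
pool charges β(y)y. Their sum is K = β(y)y - γ(α-1/2)y² - y h(-y/(T-d)). What remains is y times the
difference between the unaffected price at s and its average over (d, T].

That difference has mean zero on the fill event A. Optional stopping at the fill time, set to d off
A, replaces the price at s by the price at d; the average is handled by Fubini and the martingale
property, since A is known at time d. Hence the expected cost is ℙ(A) K
(`integral_cost_fillAndLiquidate`). Moreover ℙ(A) > 0, because the first incoming order can arrive
by d and be large enough (`measure_execution_pos`). So K < 0 would be price manipulation. Letting d
→ 0 gives the first bound, and then T → ∞ the second. -/

/-! ### Optional stopping and time averages for right-continuous martingales -/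

/-- The smallest point of the grid `ℕ / (n + 1)` that lies strictly to the right of `t`. -/
noncomputable def rightGrid (n : ℕ) (t : ℝ≥0) : ℝ≥0 := ((⌊(n + 1 : ℝ≥0) * t⌋₊ + 1 : ℕ) : ℝ≥0) / (n + 1)

lemma lt_rightGrid (n : ℕ) (t : ℝ≥0) : t < rightGrid n t := by
  unfold rightGrid
  rw [lt_div_iff₀ (by positivity), mul_comm]
  exact_mod_cast Nat.lt_floor_add_one ((n + 1 : ℝ≥0) * t)

lemma rightGrid_le (n : ℕ) (t : ℝ≥0) : rightGrid n t ≤ t + 1 / (n + 1) := by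
  unfold rightGrid
  have h : (⌊(n + 1 : ℝ≥0) * t⌋₊ : ℝ≥0) ≤ (n + 1) * t := Nat.floor_le (by positivity)
  have h1 : (t + 1 / (n + 1)) * (n + 1) = (n + 1) * t + 1 := by field_simp
  rw [div_le_iff₀ (by positivity), h1]
  push_cast
  gcongr

lemma tendsto_rightGrid (t : ℝ≥0) : Tendsto (fun n => rightGrid n t) atTop (𝓝 t) := by
  refine tendsto_of_tendsto_of_tendsto_of_le_of_le tendsto_const_nhds ?_
    (fun n => (lt_rightGrid n t).le) (fun n => rightGrid_le n t)
  simpa using tendsto_const_nhds.add (tendsto_one_div_add_atTop_nhds_zero_nat (𝕜 := ℝ≥0))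

/-- Strictness of the grid rounding turns the event into a strict comparison with the last grid
point not after `t`. This makes rounded stopping times stopping times again. -/
lemma rightGrid_le_iff (n : ℕ) (s t : ℝ≥0) :
    rightGrid n s ≤ t ↔ s < (⌊(n + 1 : ℝ≥0) * t⌋₊ : ℝ≥0) / (n + 1) := by
  unfold rightGrid
  rw [div_le_iff₀ (by positivity), lt_div_iff₀ (by positivity), mul_comm t, mul_comm s,
    ← Nat.le_floor_iff (by positivity), Nat.succ_le_iff, Nat.floor_lt (by positivity)]

/-- The rounded time depends on `p.1` only through a natural number, so countably many measurable
slices are glued together. -/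
lemma measurable_comp_rightGrid {Ω : Type*} [MeasurableSpace Ω] {X : ℝ≥0 → Ω → ℝ}
    (hX : ∀ t, Measurable (X t)) (n : ℕ) :
    Measurable (fun p : ℝ≥0 × Ω => X (rightGrid n p.1) p.2) := by
  have h : Measurable (fun q : ℕ × Ω => X (((q.1 + 1 : ℕ) : ℝ≥0) / (n + 1)) q.2) :=
    measurable_from_prod_countable_right fun k => hX (((k + 1 : ℕ) : ℝ≥0) / (n + 1))
  exact h.comp ((Nat.measurable_floor.comp (measurable_fst.const_mul _)).prodMk measurable_snd)

/-- A process with right-continuous paths is jointly measurable. -/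
lemma measurable_uncurry_of_rightContinuous {Ω : Type*} [MeasurableSpace Ω] {X : ℝ≥0 → Ω → ℝ}
    (hX : ∀ t, Measurable (X t))
    (hrc : ∀ ω t, ContinuousWithinAt (fun t => X t ω) (Set.Ici t) t) :
    Measurable (fun p : ℝ≥0 × Ω => X p.1 p.2) := by
  refine measurable_of_tendsto_metrizable (measurable_comp_rightGrid hX) ?_
  rw [tendsto_pi_nhds]
  rintro ⟨t, ω⟩
  exact (hrc ω t).tendsto.comp (tendsto_nhdsWithin_iff.2
    ⟨tendsto_rightGrid t, Eventually.of_forall fun n => (lt_rightGrid n t).le⟩)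

lemma countable_range_min_rightGrid {Ω : Type*} (s : Ω → ℝ≥0) (d : ℝ≥0) (n : ℕ) :
    (Set.range (fun ω => ((min (rightGrid n (s ω)) d : ℝ≥0) : WithTop ℝ≥0))).Countable := by
  refine (Set.countable_range
    (fun k : ℕ => ((min (((k + 1 : ℕ) : ℝ≥0) / (n + 1)) d : ℝ≥0) : WithTop ℝ≥0))).mono ?_
  rintro _ ⟨ω, rfl⟩
  exact ⟨_, rfl⟩

/-- Conditional expectation contracts the L¹ norm. The terminal norm thus bounds the norms at all
earlier times. -/
lemma MeasureTheory.Martingale.integral_norm_le {Ω : Type*} [m : MeasurableSpace Ω]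
    {P : Measure Ω} {𝒢 : Filtration ℝ≥0 m} {X : ℝ≥0 → Ω → ℝ} (hX : Martingale X 𝒢 P)
    {s t : ℝ≥0} (hst : s ≤ t) :
    ∫ ω, ‖X s ω‖ ∂P ≤ ∫ ω, ‖X t ω‖ ∂P := by
  have h : ∫ ω, ‖P[X t | 𝒢 s] ω‖ ∂P = ∫ ω, ‖X s ω‖ ∂P :=
    integral_congr_ae ((hX.condExp_ae_eq hst).fun_comp norm)
  rw [← h]
  exact integral_norm_condExp_le (X t)

section Martingale

variable {Ω : Type*} [m : MeasurableSpace Ω] {P : Measure Ω} [IsProbabilityMeasure P]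
  {𝒢 : Filtration ℝ≥0 m} {X : ℝ≥0 → Ω → ℝ}

lemma isStoppingTime_min_rightGrid {s : Ω → ℝ≥0} {d : ℝ≥0}
    (hs : IsStoppingTime 𝒢 (fun ω => (s ω : WithTop ℝ≥0))) (n : ℕ) :
    IsStoppingTime 𝒢 (fun ω => ((min (rightGrid n (s ω)) d : ℝ≥0) : WithTop ℝ≥0)) := by
  intro t
  by_cases hdt : d ≤ t
  · convert MeasurableSet.univ using 1
    ext ω
    simp only [Set.mem_ofPred_eq, WithTop.coe_le_coe, Set.mem_univ, iff_true]
    exact (min_le_right _ _).trans hdt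
  -- Here `u` is the last grid point not after `t`; the event is `{s < u}`, already known at time
  -- `u`.
  · set u : ℝ≥0 := (⌊(n + 1 : ℝ≥0) * t⌋₊ : ℝ≥0) / (n + 1) with hu
    have hut : u ≤ t := by
      rw [hu, div_le_iff₀ (by positivity), mul_comm t]
      exact Nat.floor_le (by positivity)
    convert 𝒢.mono hut _ (hs.measurableSet_lt u) using 1
    ext ω
    simp only [Set.mem_ofPred_eq, WithTop.coe_le_coe, WithTop.coe_lt_coe, min_le_iff, hdt, or_false]
    exact rightGrid_le_iff n (s ω) t

/-- Optional stopping at a bounded stopping time, for right-continuous martingales. -/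
theorem MeasureTheory.Martingale.integral_stopped_of_rightContinuous (hX : Martingale X 𝒢 P)
    (hrc : ∀ ω t, ContinuousWithinAt (fun t => X t ω) (Set.Ici t) t) {s : Ω → ℝ≥0} {d : ℝ≥0}
    (hs : IsStoppingTime 𝒢 (fun ω => (s ω : WithTop ℝ≥0))) (hsd : ∀ ω, s ω ≤ d) :
    Integrable (fun ω => X (s ω) ω) P ∧ ∫ ω, X (s ω) ω ∂P = ∫ ω, X d ω ∂P := by
  have hst := fun n => isStoppingTime_min_rightGrid (d := d) hs n
  have hle : ∀ n ω, ((min (rightGrid n (s ω)) d : ℝ≥0) : WithTop ℝ≥0) ≤ d :=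
    fun n ω => WithTop.coe_le_coe.2 (min_le_right _ _)
  set f : ℕ → Ω → ℝ := fun n ω => X (min (rightGrid n (s ω)) d) ω with hf
  -- The rounded times take countably many values, so discrete optional stopping applies. Being
  -- conditional expectations of the one variable `X d`, the `f n` are uniformly integrable, and
  -- Vitali's theorem passes to the limit.
  have hfc : ∀ n, P[X d | (hst n).measurableSpace] =ᵐ[P] f n := fun n => by
    have := hX.stoppedValue_ae_eq_condExp_of_le_const_of_countable_range (hst n) (hle n)
      (countable_range_min_rightGrid s d n)
    exact this.symm
  have hui : UniformIntegrable f 1 P :=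
    ((hX.integrable d).uniformIntegrable_condExp
      (fun n => (hst n).measurableSpace_le)).ae_eq hfc
  have hlim : ∀ ω, Tendsto (fun n => f n ω) atTop (𝓝 (X (s ω) ω)) := fun ω => by
    refine (hrc ω (s ω)).tendsto.comp (tendsto_nhdsWithin_iff.2 ⟨?_, Eventually.of_forall fun n =>
      le_min (lt_rightGrid n _).le (hsd ω)⟩)
    simpa [hsd ω] using (tendsto_rightGrid (s ω)).min (tendsto_const_nhds (x := d))
  have hint : Integrable (fun ω => X (s ω) ω) P :=
    hui.integrable_of_ae_tendsto (Eventually.of_forall hlim)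
  refine ⟨hint, ?_⟩
  have hL := tendsto_Lp_finite_of_tendsto_ae le_rfl ENNReal.one_ne_top hui.1
    (memLp_one_iff_integrable.2 hint) hui.2.1 (Eventually.of_forall hlim)
  have h1 := tendsto_integral_of_L1' _ hint.aestronglyMeasurable
    (Eventually.of_forall fun n => memLp_one_iff_integrable.1 (hui.memLp n)) hL
  have h2 : ∀ n, ∫ ω, f n ω ∂P = ∫ ω, X d ω ∂P := fun n => by
    rw [← integral_congr_ae (hfc n), integral_condExp (hst n).measurableSpace_le]
  simp_rw [h2] at h1
  exact tendsto_nhds_unique h1 tendsto_const_nhds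

/-- Tonelli: paths are jointly measurable by right-continuity, and the L¹ norm at each time is at
most that at `b`. -/
lemma MeasureTheory.Martingale.integrable_prod_of_rightContinuous (hX : Martingale X 𝒢 P)
    (hrc : ∀ ω t, ContinuousWithinAt (fun t => X t ω) (Set.Ici t) t) (a b : ℝ) :
    Integrable (fun p : ℝ × Ω => X p.1.toNNReal p.2) ((volume.restrict (Set.Ioc a b)).prod P) := by
  have hm : Measurable (fun p : ℝ × Ω => X p.1.toNNReal p.2) :=
    (measurable_uncurry_of_rightContinuous
      (fun t => (hX.stronglyMeasurable t).measurable.mono (𝒢.le t) le_rfl) hrc).comp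
      ((measurable_real_toNNReal.comp measurable_fst).prodMk measurable_snd)
  rw [integrable_prod_iff hm.aestronglyMeasurable]
  refine ⟨Eventually.of_forall fun t => hX.integrable t.toNNReal, ?_⟩
  refine Integrable.of_bound hm.stronglyMeasurable.norm.integral_prod_right'.aestronglyMeasurable
    (∫ ω, ‖X b.toNNReal ω‖ ∂P) ?_
  filter_upwards [ae_restrict_mem measurableSet_Ioc] with t ht
  rw [Real.norm_of_nonneg (integral_nonneg fun _ => norm_nonneg _)]
  exact hX.integral_norm_le (Real.toNNReal_le_toNNReal ht.2)

/-- Paths of right-continuous martingales are a.s. integrable on bounded intervals. -/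
lemma MeasureTheory.Martingale.ae_intervalIntegrable (hX : Martingale X 𝒢 P)
    (hrc : ∀ ω t, ContinuousWithinAt (fun t => X t ω) (Set.Ici t) t) {a b : ℝ} (hab : a ≤ b) :
    ∀ᵐ ω ∂P, IntervalIntegrable (fun t : ℝ => X t.toNNReal ω) volume a b := by
  filter_upwards [(hX.integrable_prod_of_rightContinuous hrc a b).prod_left_ae] with ω hω
  rwa [intervalIntegrable_iff_integrableOn_Ioc_of_le hab]

lemma MeasureTheory.Martingale.integrable_intervalIntegral (hX : Martingale X 𝒢 P)
    (hrc : ∀ ω t, ContinuousWithinAt (fun t => X t ω) (Set.Ici t) t) {a b : ℝ} (hab : a ≤ b) :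
    Integrable (fun ω => ∫ t in a..b, X t.toNNReal ω) P := by
  simp_rw [intervalIntegral.integral_of_le hab]
  exact (hX.integrable_prod_of_rightContinuous hrc a b).integral_prod_right

/-- The time average of a martingale over `[d, T]`, integrated over an event known at time `d`. -/
lemma MeasureTheory.Martingale.setIntegral_intervalIntegral (hX : Martingale X 𝒢 P)
    (hrc : ∀ ω t, ContinuousWithinAt (fun t => X t ω) (Set.Ici t) t) {d : ℝ≥0} {T : ℝ} (hdT : d ≤ T)
    {A : Set Ω} (hA : MeasurableSet[𝒢 d] A) :
    ∫ ω in A, (∫ t in (d : ℝ)..T, X t.toNNReal ω) ∂P = (T - d) * ∫ ω in A, X d ω ∂P := by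
  simp_rw [intervalIntegral.integral_of_le hdT]
  have h := (hX.integrable_prod_of_rightContinuous hrc d T).restrict (s := Set.univ ×ˢ A)
  rw [← Measure.prod_restrict, Measure.restrict_univ] at h
  -- After Fubini the inner integral over `A` does not depend on `t > d`, because `A` is known at
  -- time `d`.
  rw [← integral_integral_swap (f := fun (t : ℝ) ω => X t.toNNReal ω) h,
    setIntegral_congr_fun measurableSet_Ioc (g := fun _ => ∫ ω in A, X d ω ∂P)]
  · simp [hdT]
  · intro t ht
    exact (hX.setIntegral_eq (NNReal.le_toNNReal_of_coe_le ht.1.le) hA).symm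

end Martingale

lemma sign_mul_abs_real (x : ℝ) : Real.sign x * |x| = x := by
  rcases lt_trichotomy x 0 with h | h | h
  · rw [Real.sign_of_neg h, abs_of_neg h]; ring
  · simp [h]
  · rw [Real.sign_of_pos h, abs_of_pos h, one_mul]

namespace DarkPool

/-! ### Orders that are only executed in full -/

lemma fillSize_of_lt {X Ξ s : ℝ} {y : ℝ≥0∞} (h : y < ENNReal.ofReal Ξ) : fillSize X Ξ s y = 0 := by
  simp [fillSize, not_le.2 h]

lemma fillSize_abs_zero {X : ℝ} {y : ℝ≥0∞} (h : ENNReal.ofReal |X| ≤ y) :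
    fillSize X |X| 0 y = |X| := by
  unfold fillSize
  split_ifs with h1
  · have h2 : y = ENNReal.ofReal |X| := le_antisymm (by simpa using h1.2) h
    rw [h2, ENNReal.toReal_ofReal (abs_nonneg X)]
  · ring

/-- Nothing is left of a filled order. The branch returning `y.toReal` would need `|X| + y ≤ |X|`
with `y ≥ |X| > 0`. -/
lemma fillSize_abs_self {X : ℝ} (hX : X ≠ 0) (y : ℝ≥0∞) : fillSize X |X| |X| y = 0 := by
  unfold fillSize
  split_ifs with h1 h2
  · exfalso
    have hpos : 0 < ENNReal.ofReal |X| := ENNReal.ofReal_pos.2 (abs_pos.2 hX)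
    exact absurd h1.2 (not_le.2
      (ENNReal.lt_add_right ENNReal.ofReal_ne_top (hpos.trans_le h1.1).ne'))
  · ring
  · rfl

/-- If the minimum quantity level is the size of the order, the order is executed in full against
the first incoming order that is at least as large. -/
lemma exists_fill_eq {X : ℝ} (hX : X ≠ 0) (y : ℕ → ℝ≥0∞) {k : ℕ} (hk : ENNReal.ofReal |X| ≤ y k) :
    ∃ i ≤ k, ∀ j, fill X |X| y j = if j = i then X else 0 := by
  classical
  have hex : ∃ i, ENNReal.ofReal |X| ≤ y i := ⟨k, hk⟩
  -- The cumulative fill jumps once, from `0` to `|X|`, at the first sufficiently large order.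
  have hcum : ∀ n, cumFill X |X| y n = if Nat.find hex < n then |X| else 0 := by
    intro n
    induction n with
    | zero => simp [cumFill]
    | succ n ih =>
      rw [cumFill, ih]
      rcases lt_trichotomy n (Nat.find hex) with h | h | h
      · rw [if_neg (by lia), if_neg (by lia), fillSize_of_lt (not_le.1 (Nat.find_min hex h)), add_zero]
      · rw [if_neg (by lia), if_pos (by lia), h, fillSize_abs_zero (Nat.find_spec hex), zero_add]
      · rw [if_pos (by lia), if_pos (by lia), fillSize_abs_self hX, add_zero]
  refine ⟨Nat.find hex, Nat.find_min' hex hk, fun j => ?_⟩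
  rw [fill, hcum]
  rcases lt_trichotomy j (Nat.find hex) with h | h | h
  · rw [if_neg (by lia), if_neg (by lia), fillSize_of_lt (not_le.1 (Nat.find_min hex h)), mul_zero]
  · rw [if_neg (by lia), if_pos h, h, fillSize_abs_zero (Nat.find_spec hex), sign_mul_abs_real]
  · rw [if_pos (by lia), if_neg (by lia), fillSize_abs_self hX, mul_zero]

lemma fill_eq_zero_of_forall_lt {X : ℝ} {y : ℕ → ℝ≥0∞} (h : ∀ k, y k < ENNReal.ofReal |X|) (j : ℕ) :
    fill X |X| y j = 0 := by
  rw [fill, fillSize_of_lt (h j), mul_zero]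

/-- The time of the execution of an order that is only executed in full, or `d` if the order is not
executed up to time `d`. -/
noncomputable def execTime (X : ℝ) (τ : ℕ → ℝ≥0) (y : ℕ → ℝ≥0∞) (d : ℝ≥0) : ℝ≥0 :=
  open Classical in if Z X |X| τ y d = 0 then d else sInf {t | Z X |X| τ y t ≠ 0}

/-- Either the order is not executed up to time `d`, or it is executed in full against a single
incoming order. -/
lemma execution_cases {X : ℝ} (hX : X ≠ 0) (τ : ℕ → ℝ≥0) (y : ℕ → ℝ≥0∞) (d : ℝ≥0) :
    (execTime X τ y d = d ∧ (∀ t ≤ d, Z X |X| τ y t = 0) ∧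
      ∀ j, τ j ≤ d → fill X |X| y j = 0) ∨
    ∃ i, τ i ≤ d ∧ execTime X τ y d = τ i ∧ (∀ j, fill X |X| y j = if j = i then X else 0) ∧
      (∀ t, Z X |X| τ y t = if τ i ≤ t then X else 0) ∧
      ∀ t, Zleft X |X| τ y t = if τ i < t then X else 0 := by
  by_cases hex : ∃ k, ENNReal.ofReal |X| ≤ y k
  · obtain ⟨k, hk⟩ := hex
    obtain ⟨i, -, hi⟩ := exists_fill_eq hX y hk
    have hZ : ∀ t, Z X |X| τ y t = if τ i ≤ t then X else 0 := fun t => by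
      rw [Z, tsum_eq_single i (fun j hj => by simp [hi, hj])]
      simp [hi]
    have hZl : ∀ t, Zleft X |X| τ y t = if τ i < t then X else 0 := fun t => by
      rw [Zleft, tsum_eq_single i (fun j hj => by simp [hi, hj])]
      simp [hi]
    by_cases hd : τ i ≤ d
    · refine Or.inr ⟨i, hd, ?_, hi, hZ, hZl⟩
      have : {t | Z X |X| τ y t ≠ 0} = Set.Ici (τ i) := by
        ext t
        simp [hZ, hX]
      rw [execTime, if_neg (by simp [hZ, hd, hX]), this, csInf_Ici]
    -- A large enough order exists but arrives only after `d`.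
    · refine Or.inl ⟨?_, fun t ht => ?_, fun j hj => ?_⟩
      · rw [execTime, if_pos (by simp [hZ, hd])]
      · rw [hZ, if_neg (fun h => hd (h.trans ht))]
      · rw [hi, if_neg (by rintro rfl; exact hd hj)]
  · have hf := fill_eq_zero_of_forall_lt (X := X) (y := y) (by simpa using hex)
    have hZ : ∀ t, Z X |X| τ y t = 0 := fun t => by simp [Z, hf]
    exact Or.inl ⟨by rw [execTime, if_pos (hZ d)], fun t _ => hZ t, fun j _ => hf j⟩

lemma execTime_le {X : ℝ} (hX : X ≠ 0) (τ : ℕ → ℝ≥0) (y : ℕ → ℝ≥0∞) (d : ℝ≥0) :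
    execTime X τ y d ≤ d := by
  rcases execution_cases hX τ y d with h | ⟨i, hi, h, -⟩
  · exact h.1.le
  · exact h ▸ hi

/-- Before `d`, having been executed is visible from `Z` at time `t` alone; this makes the execution
time a stopping time of `G`. -/
lemma execTime_le_iff {X : ℝ} (hX : X ≠ 0) (τ : ℕ → ℝ≥0) (y : ℕ → ℝ≥0∞) {d t : ℝ≥0} (ht : t < d) :
    execTime X τ y d ≤ t ↔ Z X |X| τ y t ≠ 0 := by
  rcases execution_cases hX τ y d with ⟨h, hZ, -⟩ | ⟨i, -, h, -, hZ, -⟩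
  · simp [h, hZ t ht.le, ht]
  · simp [h, hZ, hX]

lemma Z_eq_zero_or {X : ℝ} (hX : X ≠ 0) (τ : ℕ → ℝ≥0) (y : ℕ → ℝ≥0∞) (d : ℝ≥0) :
    Z X |X| τ y d = 0 ∨ Z X |X| τ y d = X := by
  rcases execution_cases hX τ y d with ⟨-, hZ, -⟩ | ⟨i, hi, -, -, hZ, -⟩
  · exact Or.inl (hZ d le_rfl)
  · simp [hZ, hi]

lemma Z_ne_zero_of_le {X : ℝ} (hX : X ≠ 0) {τ : ℕ → ℝ≥0} {y : ℕ → ℝ≥0∞} {d : ℝ≥0}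
    (hτ : τ 0 ≤ d) (hy : ENNReal.ofReal |X| ≤ y 0) : Z X |X| τ y d ≠ 0 := by
  obtain ⟨i, hi0, hi⟩ := exists_fill_eq hX y hy
  obtain rfl : i = 0 := by lia
  rw [Z, tsum_eq_single 0 (fun j hj => by simp [hi, hj])]
  simp [hi, hτ, hX]

end DarkPool

/-! ### The round trip and its admissibility -/

namespace DarkPoolExtension

variable {Ω : Type*} [m : MeasurableSpace Ω] {ℙ : Measure Ω} {M : AlmgrenChriss ℙ}

lemma measurable_G_Z (D : DarkPoolExtension M) (χ : DarkPoolStrategy Ω) (t : ℝ≥0) :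
    Measurable[D.G χ t] (D.Z χ t) := by
  have h1 := (Filtration.stronglyAdapted_natural (fun t =>
    (DarkPool.measurable_Z χ.Xhat χ.Ξ D.τ_measurable D.Y_measurable t).stronglyMeasurable) t).measurable
  refine h1.mono (le_trans ?_ (Filtration.le_rightCont _ t)) le_rfl
  exact (le_sup_right.trans le_sup_left : Filtration.natural _ _ ≤ _) t

/-- The strategy that places an order of size `y` in the dark pool, to be executed in full up to time
`d` or else cancelled, and that liquidates the resulting position at constant speed over `(d, T]`. -/
noncomputable def fillAndLiquidate (D : DarkPoolExtension M) (y : ℝ) (d : ℝ≥0) (T : ℝ) :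
    DarkPoolStrategy Ω where
  Xhat := y
  Ξ := |y|
  ξ t ω := if d < t then -DarkPool.Z y |y| (fun i => D.τ i ω) (fun i => D.Y i ω) d / (T - d) else 0
  ρ _ := d

section

variable (D : DarkPoolExtension M) {y : ℝ} {d : ℝ≥0} {T : ℝ} {ω : Ω}

lemma fillAndLiquidate_ξ_of_le {t : ℝ≥0} (ht : t ≤ d) : (D.fillAndLiquidate y d T).ξ t ω = 0 := by
  simp [fillAndLiquidate, not_lt.2 ht]

lemma fillAndLiquidate_ξ_of_lt {t : ℝ≥0} (ht : d < t) :
    (D.fillAndLiquidate y d T).ξ t ω = -D.Z (D.fillAndLiquidate y d T) d ω / (T - d) := by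
  simp [fillAndLiquidate, ht, Z]

/-- The integrand is kept general so that one splitting at `d` serves for the position, the exchange
costs and the cross-impact term. -/
lemma fillAndLiquidate_eqOn_left (f : ℝ → ℝ → ℝ) :
    Set.EqOn (fun t : ℝ => f t ((D.fillAndLiquidate y d T).ξ t.toNNReal ω)) (fun t => f t 0)
      (Set.uIoc 0 d) := by
  intro t ht
  rw [Set.uIoc_of_le d.coe_nonneg] at ht
  simp only
  rw [fillAndLiquidate_ξ_of_le]
  exact Real.toNNReal_le_iff_le_coe.2 ht.2

lemma fillAndLiquidate_eqOn_right (f : ℝ → ℝ → ℝ) {t : ℝ} (hdt : d ≤ t) :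
    Set.EqOn (fun t : ℝ => f t ((D.fillAndLiquidate y d T).ξ t.toNNReal ω))
      (fun t => f t (-D.Z (D.fillAndLiquidate y d T) d ω / (T - d))) (Set.uIoc d t) := by
  intro s hs
  rw [Set.uIoc_of_le hdt] at hs
  simp only
  rw [fillAndLiquidate_ξ_of_lt]
  exact Real.lt_toNNReal_iff_coe_lt.2 hs.1

/-- Integrals over `[0, t]` of functionals of the speed that vanish at speed zero. -/
lemma fillAndLiquidate_integral (f : ℝ → ℝ → ℝ) (hf : ∀ t, f t 0 = 0) {t : ℝ} (hdt : d ≤ t)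
    (hi : IntervalIntegrable (fun t => f t (-D.Z (D.fillAndLiquidate y d T) d ω / (T - d)))
      volume d t) :
    IntervalIntegrable (fun t : ℝ => f t ((D.fillAndLiquidate y d T).ξ t.toNNReal ω)) volume 0 t ∧
    ∫ t in (0 : ℝ)..t, f t ((D.fillAndLiquidate y d T).ξ t.toNNReal ω) =
      ∫ t in (d : ℝ)..t, f t (-D.Z (D.fillAndLiquidate y d T) d ω / (T - d)) := by
  have hl := D.fillAndLiquidate_eqOn_left (y := y) (d := d) (T := T) (ω := ω) f
  have hr := D.fillAndLiquidate_eqOn_right (y := y) (d := d) (T := T) (ω := ω) f hdt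
  simp only [hf] at hl
  have hil : IntervalIntegrable (fun t : ℝ => f t ((D.fillAndLiquidate y d T).ξ t.toNNReal ω))
      volume 0 d := (intervalIntegrable_congr hl).2 (intervalIntegrable_const (c := (0 : ℝ)))
  have hir := (intervalIntegrable_congr hr).2 hi
  refine ⟨hil.trans hir, ?_⟩
  rw [← intervalIntegral.integral_add_adjacent_intervals hil hir,
    intervalIntegral.integral_congr_ae (Eventually.of_forall hl),
    intervalIntegral.integral_congr_ae (Eventually.of_forall hr)]
  simp

lemma fillAndLiquidate_intξ_of_le {t : ℝ} (h0 : 0 ≤ t) (ht : t ≤ d) :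
    (D.fillAndLiquidate y d T).intξ t ω = 0 := by
  rw [DarkPoolStrategy.intξ, intervalIntegral.integral_congr_ae (g := fun _ => 0)]
  · simp
  · refine Eventually.of_forall fun s hs => ?_
    rw [Set.uIoc_of_le h0] at hs
    exact D.fillAndLiquidate_ξ_of_le (Real.toNNReal_le_iff_le_coe.2 (hs.2.trans ht))

lemma fillAndLiquidate_intξ_of_ge {t : ℝ} (ht : d ≤ t) :
    (D.fillAndLiquidate y d T).intξ t ω =
      (t - d) * (-D.Z (D.fillAndLiquidate y d T) d ω / (T - d)) := by
  have := (D.fillAndLiquidate_integral (y := y) (d := d) (T := T) (ω := ω)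
    (fun _ x => x) (fun _ => rfl) ht (by simp)).2
  rw [DarkPoolStrategy.intξ, this, intervalIntegral.integral_const, smul_eq_mul]

lemma abs_Z_fillAndLiquidate_le (hy : y ≠ 0) : |D.Z (D.fillAndLiquidate y d T) d ω| ≤ |y| := by
  rcases DarkPool.Z_eq_zero_or hy (fun i => D.τ i ω) (fun i => D.Y i ω) d with h | h <;>
  · rw [Z]
    simp only [fillAndLiquidate]
    simp [h]

/-- The speed is a variable known at time `d`, carried by the predictable set `(d, ∞) × Ω`, and zero
elsewhere. -/
lemma fillAndLiquidate_predictable :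
    IsStronglyPredictable (D.G (D.fillAndLiquidate y d T)) (D.fillAndLiquidate y d T).ξ := by
  set χ := D.fillAndLiquidate y d T with hχ
  have hW : Measurable[D.G χ d] (fun ω => -D.Z χ d ω / (T - d)) :=
    (@Measurable.neg _ _ _ _ _ (D.G χ d) _ (D.measurable_G_Z χ d)).div_const _
  refine @Measurable.stronglyMeasurable _ _ _ (D.G χ).predictable _ _ _ _ _ ?_
  intro s hs
  have hset : Function.uncurry χ.ξ ⁻¹' s =
      (Set.Ioi d ×ˢ ((fun ω => -D.Z χ d ω / (T - d)) ⁻¹' s)) ∪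
      ((Set.Ioi d ×ˢ Set.univ)ᶜ ∩ {_p | (0 : ℝ) ∈ s}) := by
    ext ⟨t, ω⟩
    by_cases ht : d < t
    · simp [Function.uncurry, ht, hχ, fillAndLiquidate_ξ_of_lt]
    · simp [Function.uncurry, ht, hχ, fillAndLiquidate_ξ_of_le D (not_lt.1 ht)]
  rw [hset]
  refine MeasurableSet.union (measurableSet_predictable_Ioi_prod (hW hs))
    ((measurableSet_predictable_Ioi_prod MeasurableSet.univ).compl.inter (MeasurableSet.const _))

lemma fillAndLiquidate_isAdmissible (hy : y ≠ 0) (hdT : d < T) :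
    D.IsAdmissible 0 T (D.fillAndLiquidate y d T) where
  Ξ_mem := ⟨abs_nonneg y, le_rfl⟩
  ρ_stopping := isStoppingTime_const _ d
  ρ_lt := Eventually.of_forall fun _ => hdT
  ξ_predictable := D.fillAndLiquidate_predictable
  ξ_integrable := Eventually.of_forall fun ω =>
    (D.fillAndLiquidate_integral (fun _ x => x) (fun _ => rfl) hdT.le (by simp)).1
  intξ_bounded := by
    refine ⟨|y|, Eventually.of_forall fun ω t ht => ?_⟩
    rcases le_total t d with h | h
    · rw [fillAndLiquidate_intξ_of_le D ht.1 h]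
      simp
    · have hpos : 0 < T - d := sub_pos.2 hdT
      rw [fillAndLiquidate_intξ_of_ge D h, abs_mul, abs_div, abs_neg, abs_of_pos hpos,
        abs_of_nonneg (sub_nonneg.2 h), mul_div_left_comm]
      refine (mul_le_of_le_one_right (abs_nonneg _) ?_).trans (D.abs_Z_fillAndLiquidate_le hy)
      rw [div_le_one hpos]
      linarith [ht.2]
  liquidation := Eventually.of_forall fun ω => by
    have hpos : T - d ≠ 0 := (sub_pos.2 hdT).ne'
    rw [fillAndLiquidate_intξ_of_ge D hdT.le]
    change 0 + _ + D.Z _ d ω = 0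
    field_simp
    ring

end

end DarkPoolExtension

/-! ### Costs of the round trip along a path -/

namespace DarkPoolExtension

variable {Ω : Type*} [m : MeasurableSpace Ω] {ℙ : Measure Ω} {M : AlmgrenChriss ℙ}

section

variable (D : DarkPoolExtension M) {y : ℝ} {d : ℝ≥0} {T : ℝ} {ω : Ω}

/-- With constant speed `c = -z / (T - d)` the impact grows linearly, so it contributes `γ c² (T -
d)² / 2 = γ z² / 2`. -/
lemma fillAndLiquidate_integral_exchange (hdT : d < T)
    (hP : IntervalIntegrable (fun t : ℝ => M.P0 t.toNNReal ω) volume d T) :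
    IntervalIntegrable (fun t : ℝ => (D.fillAndLiquidate y d T).ξ t.toNNReal ω *
      D.exchangePrice (D.fillAndLiquidate y d T) t.toNNReal ω) volume 0 T ∧
    ∫ t in (0 : ℝ)..T, (D.fillAndLiquidate y d T).ξ t.toNNReal ω *
      D.exchangePrice (D.fillAndLiquidate y d T) t.toNNReal ω =
    -D.Z (D.fillAndLiquidate y d T) d ω / (T - d) * (∫ t in (d : ℝ)..T, M.P0 t.toNNReal ω) +
      M.γ / 2 * D.Z (D.fillAndLiquidate y d T) d ω ^ 2 -
      D.Z (D.fillAndLiquidate y d T) d ω *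
        M.h (-D.Z (D.fillAndLiquidate y d T) d ω / (T - d)) := by
  set χ := D.fillAndLiquidate y d T with hχ
  set z := D.Z χ d ω with hz
  set c := -z / (T - d) with hc
  have hpos : T - d ≠ 0 := (sub_pos.2 hdT).ne'
  have hEq : Set.EqOn
      (fun t : ℝ => c * (M.P0 t.toNNReal ω + M.γ * χ.intξ (t.toNNReal : ℝ) ω + M.h c))
      (fun t => c * M.P0 t.toNNReal ω + (M.γ * c ^ 2 * (t - d) + c * M.h c)) (Set.uIoc d T) := by
    intro t ht
    rw [Set.uIoc_of_le hdT.le] at ht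
    have h0 : 0 ≤ t := d.coe_nonneg.trans ht.1.le
    simp only [Real.coe_toNNReal t h0]
    rw [hχ, fillAndLiquidate_intξ_of_ge D ht.1.le]
    ring
  have hcont : Continuous (fun t : ℝ => M.γ * c ^ 2 * (t - d) + c * M.h c) := by fun_prop
  have hi := (hP.const_mul c).add (hcont.intervalIntegrable d T)
  obtain ⟨h1, h2⟩ := D.fillAndLiquidate_integral (y := y) (d := d) (T := T) (ω := ω)
    (fun t x => x * (M.P0 t.toNNReal ω + M.γ * χ.intξ (t.toNNReal : ℝ) ω + M.h x))
    (fun t => zero_mul _) hdT.le ((intervalIntegrable_congr hEq).2 hi)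
  refine ⟨h1, h2.trans ?_⟩
  rw [intervalIntegral.integral_congr_ae (Eventually.of_forall hEq),
    intervalIntegral.integral_add (hP.const_mul c) (hcont.intervalIntegrable d T),
    intervalIntegral.integral_const_mul,
    intervalIntegral.integral_add ((by fun_prop : Continuous _).intervalIntegrable d T)
      (by simp), intervalIntegral.integral_const_mul, intervalIntegral.integral_const,
    intervalIntegral.integral_sub (by simp) (by simp), integral_id,
    intervalIntegral.integral_const, smul_eq_mul, smul_eq_mul, hc]
  field_simp
  ring

/-- Trading happens only after `d`, when `Z` is frozen at its value at `d`, and amounts in total to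
minus that value. -/
lemma fillAndLiquidate_integral_Z (hdT : d < T) :
    ∫ t in (0 : ℝ)..T, D.Z (D.fillAndLiquidate y d T)
      (min ((D.fillAndLiquidate y d T).ρ ω) t.toNNReal) ω *
        (D.fillAndLiquidate y d T).ξ t.toNNReal ω =
      -D.Z (D.fillAndLiquidate y d T) d ω ^ 2 := by
  set χ := D.fillAndLiquidate y d T with hχ
  set z := D.Z χ d ω with hz
  have hpos : T - d ≠ 0 := (sub_pos.2 hdT).ne'
  have hEq : Set.EqOn
      (fun t : ℝ => D.Z χ (min d t.toNNReal) ω * (-z / (T - d)))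
      (fun t => z * (-z / (T - d))) (Set.uIoc d T) := by
    intro t ht
    rw [Set.uIoc_of_le hdT.le] at ht
    simp only
    rw [min_eq_left (NNReal.le_toNNReal_of_coe_le ht.1.le)]
  refine (D.fillAndLiquidate_integral (y := y) (d := d) (T := T) (ω := ω)
    (fun t x => D.Z χ (min d t.toNNReal) ω * x) (fun t => mul_zero _) hdT.le
    ((intervalIntegrable_congr hEq).2 (by simp))).2.trans ?_
  rw [intervalIntegral.integral_congr_ae (Eventually.of_forall hEq),
    intervalIntegral.integral_const, smul_eq_mul]
  field_simp

/-- At most one summand is nonzero. At its arrival nothing has been traded on the exchange or in the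
pool, so all impact terms except `β` vanish. -/
lemma fillAndLiquidate_hasSum_darkCost (hy : y ≠ 0) :
    HasSum (fun i => D.darkCost (D.fillAndLiquidate y d T) i ω)
      (D.Z (D.fillAndLiquidate y d T) d ω *
        (M.P0 (DarkPool.execTime y (fun i => D.τ i ω) (fun i => D.Y i ω) d) ω +
          D.β (D.Z (D.fillAndLiquidate y d T) d ω))) := by
  rcases DarkPool.execution_cases hy (fun i => D.τ i ω) (fun i => D.Y i ω) d with
    ⟨-, hZ, hf⟩ | ⟨i, hi, hs, hf, hZ, hZl⟩
  · have hz : D.Z (D.fillAndLiquidate y d T) d ω = 0 := hZ d le_rfl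
    rw [hz, zero_mul]
    have h0 : ∀ j, D.darkCost (D.fillAndLiquidate y d T) j ω = 0 := fun j => by
      unfold darkCost
      split_ifs with h
      · have : D.fill (D.fillAndLiquidate y d T) j ω = 0 := hf j h
        rw [this, zero_mul]
      · rfl
    simp_rw [h0]
    exact hasSum_zero
  · have hz : D.Z (D.fillAndLiquidate y d T) d ω = y := (hZ d).trans (if_pos hi)
    have hf' : ∀ j, D.fill (D.fillAndLiquidate y d T) j ω = if j = i then y else 0 := hf
    have hZl' : D.Zleft (D.fillAndLiquidate y d T) (D.τ i ω) ω = 0 :=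
      (hZl (D.τ i ω)).trans (if_neg (lt_irrefl _))
    rw [hz, hs]
    convert hasSum_single i (f := fun j => D.darkCost (D.fillAndLiquidate y d T) j ω) ?_ using 1
    · have hi' : D.τ i ω ≤ (D.fillAndLiquidate y d T).ρ ω := hi
      rw [darkCost, if_pos hi', hf', if_pos rfl, hZl', darkPrice,
        fillAndLiquidate_intξ_of_le D (D.τ i ω).coe_nonneg (NNReal.coe_le_coe.2 hi),
        fillAndLiquidate_ξ_of_le D hi, M.h_impact.map_zero]
      ring
    · intro j hj
      simp [darkCost, hf', hj]

/-- The costs of the strategy, path by path. -/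
lemma cost_fillAndLiquidate (hy : y ≠ 0) (hdT : d < T)
    (hP : IntervalIntegrable (fun t : ℝ => M.P0 t.toNNReal ω) volume d T) :
    D.cost 0 T (D.fillAndLiquidate y d T) ω =
      Set.indicator {ω | D.Z (D.fillAndLiquidate y d T) d ω ≠ 0} (fun ω =>
        y * M.P0 (DarkPool.execTime y (fun i => D.τ i ω) (fun i => D.Y i ω) d) ω
          - y / (T - d) * (∫ t in (d : ℝ)..T, M.P0 t.toNNReal ω)
          + (D.β y * y - (M.γ * (D.α - 1 / 2) * y ^ 2 + y * M.h (-y / (T - d))))) ω := by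
  rw [cost, (D.fillAndLiquidate_integral_exchange hdT hP).2, D.fillAndLiquidate_integral_Z hdT,
    (D.fillAndLiquidate_hasSum_darkCost hy).tsum_eq]
  rcases DarkPool.Z_eq_zero_or hy (fun i => D.τ i ω) (fun i => D.Y i ω) d with h | h
  · have hz : D.Z (D.fillAndLiquidate y d T) d ω = 0 := h
    rw [Set.indicator_of_notMem (by simp [hz]), hz]
    simp
  · have hz : D.Z (D.fillAndLiquidate y d T) d ω = y := h
    rw [Set.indicator_of_mem (by simp [hz, hy]), hz]
    ring

lemma finiteCost_fillAndLiquidate [IsProbabilityMeasure ℙ] (hy : y ≠ 0) (hdT : d < T) :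
    D.FiniteCost T (D.fillAndLiquidate y d T) := by
  filter_upwards [M.P0_martingale.ae_intervalIntegrable
    (fun ω t => (M.P0_cadlag ω t).1) hdT.le] with ω hω
  exact ⟨(D.fillAndLiquidate_integral_exchange hdT hω).1,
    (D.fillAndLiquidate_hasSum_darkCost hy).summable⟩

/-! ### Expected costs of the round trip -/

lemma execTime_isStoppingTime (hy : y ≠ 0) :
    IsStoppingTime (D.G (D.fillAndLiquidate y d T)) (fun ω =>
      ((DarkPool.execTime y (fun i => D.τ i ω) (fun i => D.Y i ω) d : ℝ≥0) : WithTop ℝ≥0)) := by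
  intro t
  rcases lt_or_ge t d with ht | ht
  · convert (D.measurable_G_Z (D.fillAndLiquidate y d T) t)
      (measurableSet_singleton (0 : ℝ)).compl using 1
    ext ω
    rw [Set.mem_ofPred_eq, WithTop.coe_le_coe, DarkPool.execTime_le_iff hy _ _ ht]
    rfl
  · convert MeasurableSet.univ using 1
    ext ω
    simp only [Set.mem_ofPred_eq, WithTop.coe_le_coe, Set.mem_univ, iff_true]
    exact (DarkPool.execTime_le hy _ _ d).trans ht

lemma measurableSet_execution :
    MeasurableSet[D.G (D.fillAndLiquidate y d T) d]
      {ω | D.Z (D.fillAndLiquidate y d T) d ω ≠ 0} :=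
  D.measurable_G_Z (D.fillAndLiquidate y d T) d (measurableSet_singleton (0 : ℝ)).compl

/-- An order of any size is executed in full with positive probability in any time interval. -/
lemma measure_execution_pos (hy : y ≠ 0) (hd : 0 < d) :
    ℙ {ω | D.Z (D.fillAndLiquidate y d T) d ω ≠ 0} ≠ 0 := by
  intro h0
  have h1 := (D.lambda1_pos |y| (abs_pos.2 hy)).trans_le (iInf₂_le d hd)
  have h2 : ℙ ({ω | D.τ 0 ω ≤ d} ∩ {ω | ENNReal.ofReal |y| ≤ D.Y 0 ω}) = 0 :=
    measure_mono_null (fun ω hω => DarkPool.Z_ne_zero_of_le hy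
      (τ := fun i => D.τ i ω) (y := fun i => D.Y i ω) hω.1 hω.2) h0
  -- If execution were null, the conditional probability in `h1` would vanish, against its positive
  -- lower bound.
  rw [ProbabilityTheory.cond_apply (measurableSet_le (D.τ_measurable 0) measurable_const), h2,
    mul_zero] at h1
  exact lt_irrefl _ h1

lemma integral_cost_fillAndLiquidate [IsProbabilityMeasure ℙ] (hy : y ≠ 0) (hdT : d < T) :
    Integrable (D.cost 0 T (D.fillAndLiquidate y d T)) ℙ ∧
    ∫ ω, D.cost 0 T (D.fillAndLiquidate y d T) ω ∂ℙ =
      ℙ.real {ω | D.Z (D.fillAndLiquidate y d T) d ω ≠ 0} *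
        (D.β y * y - (M.γ * (D.α - 1 / 2) * y ^ 2 + y * M.h (-y / (T - d)))) := by
  set χ := D.fillAndLiquidate y d T with hχ
  set A := {ω | D.Z χ d ω ≠ 0}
  set K := D.β y * y - (M.γ * (D.α - 1 / 2) * y ^ 2 + y * M.h (-y / (T - d)))
  have hX : Martingale M.P0 (D.G χ) ℙ := D.P0_martingale y |y| ⟨abs_nonneg y, le_rfl⟩
  have hrc : ∀ ω t, ContinuousWithinAt (fun t => M.P0 t ω) (Set.Ici t) t :=
    fun ω t => (M.P0_cadlag ω t).1
  have hAG : MeasurableSet[D.G χ d] A := D.measurableSet_execution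
  have hA : MeasurableSet A := (D.G χ).le d _ hAG
  obtain ⟨hs, hsE⟩ := hX.integral_stopped_of_rightContinuous hrc (D.execTime_isStoppingTime hy)
    (fun ω => DarkPool.execTime_le hy _ _ d)
  have havg := hX.integrable_intervalIntegral hrc hdT.le
  have hcost : D.cost 0 T χ =ᵐ[ℙ] A.indicator (fun ω =>
      y * M.P0 (DarkPool.execTime y (fun i => D.τ i ω) (fun i => D.Y i ω) d) ω
        - y / (T - d) * (∫ t in (d : ℝ)..T, M.P0 t.toNNReal ω) + K) := by
    filter_upwards [hX.ae_intervalIntegrable hrc hdT.le] with ω hω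
    exact D.cost_fillAndLiquidate hy hdT hω
  -- Optional stopping equates the integrals over all of `Ω`. Off `A` the execution time is `d`, so
  -- the integrands agree there and the identity restricts to `A`.
  have hexec : ∫ ω in A, M.P0 (DarkPool.execTime y (fun i => D.τ i ω) (fun i => D.Y i ω) d) ω ∂ℙ =
      ∫ ω in A, M.P0 d ω ∂ℙ := by
    have hc : ∫ ω in Aᶜ, M.P0 (DarkPool.execTime y (fun i => D.τ i ω) (fun i => D.Y i ω) d) ω ∂ℙ =
        ∫ ω in Aᶜ, M.P0 d ω ∂ℙ := by
      refine setIntegral_congr_fun hA.compl fun ω hω => ?_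
      have hω' : DarkPool.Z y |y| (fun i => D.τ i ω) (fun i => D.Y i ω) d = 0 := by
        by_contra h
        exact hω h
      simp only [DarkPool.execTime, if_pos hω']
    have h1 := integral_add_compl hA hs
    have h2 := integral_add_compl hA (hX.integrable d)
    linarith
  have hdiff : Integrable (fun ω =>
      y * M.P0 (DarkPool.execTime y (fun i => D.τ i ω) (fun i => D.Y i ω) d) ω
        - y / (T - d) * (∫ t in (d : ℝ)..T, M.P0 t.toNNReal ω)) ℙ :=
    (hs.const_mul y).sub (havg.const_mul (y / (T - d)))
  refine ⟨((hdiff.add (integrable_const K)).indicator hA).congr hcost.symm, ?_⟩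
  have hpos : T - d ≠ 0 := (sub_pos.2 hdT).ne'
  rw [integral_congr_ae hcost, integral_indicator hA,
    integral_add hdiff.integrableOn (integrable_const K).integrableOn,
    integral_sub (hs.const_mul y).integrableOn (havg.const_mul (y / (T - d))).integrableOn,
    integral_const_mul, integral_const_mul, hexec, hX.setIntegral_intervalIntegral hrc hdT.le hAG,
    setIntegral_const, smul_eq_mul]
  field_simp
  ring

end

/-! ### From negative expected costs to the two bounds -/

/-- If the bound fails for the liquidation period `T - d`, then the horizon `T` admits price
manipulation. -/
lemma priceManipulation_of_lt [IsProbabilityMeasure ℙ] (D : DarkPoolExtension M) {y : ℝ} {d : ℝ≥0}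
    {T : ℝ} (hy : y ≠ 0) (hd : 0 < d) (hdT : d < T)
    (h : D.β y * y < M.γ * (D.α - 1 / 2) * y ^ 2 + y * M.h (-y / (T - d))) :
    D.PriceManipulation T := by
  obtain ⟨hi, hE⟩ := D.integral_cost_fillAndLiquidate hy hdT
  refine ⟨_, D.fillAndLiquidate_isAdmissible hy hdT, D.finiteCost_fillAndLiquidate hy hdT, ?_⟩
  have hneg : ∫ ω, D.cost 0 T (D.fillAndLiquidate y d T) ω ∂ℙ < 0 := by
    rw [hE]
    exact mul_neg_of_pos_of_neg
      (ENNReal.toReal_pos (D.measure_execution_pos hy hd) (measure_ne_top _ _)) (by linarith)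
  -- Both parts of the integrable cost have finite integral, so the sign of the expectation becomes
  -- the comparison in `[0, ∞]`.
  rw [integral_eq_lintegral_pos_part_sub_lintegral_neg_part hi, sub_neg] at hneg
  exact (ENNReal.toReal_lt_toReal hi.lintegral_lt_top.ne hi.neg.lintegral_lt_top.ne).1 hneg

/-- The bound holds with liquidation period `T - d` for every `d` in `(0, T)`; continuity of `h`
allows `d → 0`. -/
lemma le_of_not_priceManipulation [IsProbabilityMeasure ℙ] (D : DarkPoolExtension M) {T : ℝ}
    (hT : 0 < T) (hD : ¬ D.PriceManipulation T) (y : ℝ) :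
    M.γ * (D.α - 1 / 2) * y ^ 2 + y * M.h (-y / T) ≤ D.β y * y := by
  rcases eq_or_ne y 0 with rfl | hy
  · simp
  have hcont : ContinuousAt
      (fun d : ℝ => M.γ * (D.α - 1 / 2) * y ^ 2 + y * M.h (-y / (T - d))) 0 := by
    have hdiv : ContinuousAt (fun d : ℝ => -y / (T - d)) 0 :=
      continuousAt_const.div (continuousAt_const.sub continuousAt_id) (by simpa using hT.ne')
    exact continuousAt_const.add
      (continuousAt_const.mul (M.h_impact.continuous.continuousAt.comp hdiv))
  have hlim := hcont.tendsto.mono_left (nhdsWithin_le_nhds (s := Set.Ioi 0))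
  rw [sub_zero] at hlim
  refine le_of_tendsto hlim ?_
  filter_upwards [Ioo_mem_nhdsGT hT] with d hd
  by_contra! h
  lift d to ℝ≥0 using hd.1.le
  exact hD (D.priceManipulation_of_lt hy (by exact_mod_cast hd.1) hd.2 h)

end DarkPoolExtension

theorem mainTheorem2 {Ω : Type*} [MeasurableSpace Ω] (ℙ : Measure Ω) [IsProbabilityMeasure ℙ]
    (M : AlmgrenChriss ℙ) (D : DarkPoolExtension M) :
    (∀ T : ℝ, 0 < T → ¬ D.PriceManipulation T →
      ∀ y : ℝ, M.γ * (D.α - 1 / 2) * y ^ 2 + y * M.h (-y / T) ≤ D.β y * y) ∧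
    ((∀ T : ℝ, 0 < T → ¬ D.PriceManipulation T) →
      ∀ y : ℝ, M.γ * (D.α - 1 / 2) * |y| ≤ |D.β y|) := by
  refine ⟨fun T hT hD y => D.le_of_not_priceManipulation hT hD y, fun hD y => ?_⟩
  rcases eq_or_ne y 0 with rfl | hy
  · simp
  -- Liquidation over an ever longer horizon makes the temporary impact vanish, as `-y / T → 0` and
  -- `h 0 = 0`.
  have hlim : Tendsto (fun T : ℝ => M.γ * (D.α - 1 / 2) * y ^ 2 + y * M.h (-y / T)) atTop
      (𝓝 (M.γ * (D.α - 1 / 2) * y ^ 2 + y * M.h 0)) :=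
    ((M.h_impact.continuous.tendsto 0).comp
      (tendsto_const_nhds.div_atTop tendsto_id)).const_mul y |>.const_add _
  have h := le_of_tendsto hlim ((eventually_gt_atTop 0).mono fun T hT =>
    D.le_of_not_priceManipulation hT (hD T hT) y)
  rw [M.h_impact.map_zero, mul_zero, add_zero] at h
  have hpos := abs_pos.2 hy
  have h' := h.trans (le_abs_self _)
  -- With `y² = |y| |y|`, a factor `|y| > 0` cancels.
  rw [abs_mul, ← sq_abs, pow_two, ← mul_assoc] at h'
  exact le_of_mul_le_mul_right h' hpos
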